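/- Let $d\ge 1$, let $\Omega\subset\mathbb{R}^d$ be a bounded connected open set with smooth boundary, and let $K\subset\Omega$ be compact. Let $(g_N,g_D)\in H^{-1/2}(\partial\Omega)\times H^{1/2}(\partial\Omega)$ be a non-trivial (i.e. not both zero) pair. Let $$\mathcal{A}=\{A=\Omega\setminus\overline{\omega}\;:\;\omega\text{ open},\ \omega\subset K,\ \omega\text{ Lipschitz}\},$$ where $\omega$ is Lipschitz if near each of its boundary points it coincides, in suitable orthonormal coordinates, with the set of points strictly above the graph of a Lipschitz function. For $A=\Omega\setminus\overline{\omega}\in\mathcal{A}$ let $u\in H^1(A)$ be the weak solution of $$-\Delta u+u=0\ \text{in }A,\qquad \partial_\nu u=g_N\ \text{on }\partial\Omega,\qquad u=0\ \text{on }\partial\omega,$$ and set $$\mathcal{L}(A)=\frac12\int_{\partial\Omega}|u-g_D|^2 .$$ For $y,\xi\in\mathbb{R}^d$ with $|\xi|=1$ and $\varepsilon>0$ let $$C(y,\xi,\varepsilon)=\{z\in\mathbb{R}^d:\ (z-y)\cdot\xi\ge\cos(\varepsilon)|z-y|,\ 0<|z-y|<\varepsilon\}.$$ A set $\Theta\subset\mathbb{R}^d$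 has the $\varepsilon$-cone property if for every $x\in\partial\Theta$ there is a unit vector $\xi_x$ such that $C(y,\xi_x,\varepsilon)\subset\Theta$ for all $y\in\overline{\Theta}$ with $|y-x|<\varepsilon$. Let $$\mathcal{A}_\varepsilon=\{A=\Omega\setminus\overline{\omega}\;:\;\omega\text{ open},\ \omega\subset K,\ \omega^c=\mathbb{R}^d\setminus\omega\text{ has the }\varepsilon\text{-cone property}\}.$$ Suppose that $\mathcal{L}$ admits a minimizer $A^*$ over $\mathcal{A}$, that is, $A^*\in\mathcal{A}$ and $\mathcal{L}(A^*)\le\mathcal{L}(A)$ for all $A\in\mathcal{A}$. Then there exists $\varepsilon_0>0$ such that, for every $\varepsilon\in(0,\varepsilon_0)$, $A^*$ is a minimizer of $\mathcal{L}$ over $\mathcal{A}_\varepsilon$, that is, $A^*\in\mathcal{A}_\varepsilon$ and $\mathcal{L}(A^*)\le\mathcal{L}(A)$ for all $A\in\mathcal{A}_\varepsilon$. -/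

import Mathlib

open MeasureTheory Filter Topology Set
open scoped ContDiff ENNReal RealInnerProductSpace

noncomputable section

namespace Obstacle

/-- The space `ℝ^d` with its Euclidean structure. -/
abbrev E (d : ℕ) : Type := EuclideanSpace ℝ (Fin d)

variable {d : ℕ}

/-! ### Regularity of open sets -/

/-- Near the point `x`, the set `s` is the part lying strictly above the graph of `φ`, where `φ` is
defined on the hyperplane orthogonal to `e` and heights are measured along `e`. Since this describes
`s` on a full neighbourhood of `x`, `s` lies (locally) on one side of its boundary. -/
def IsLocalEpigraph (s : Set (E d)) (x e : E d) (φ : (ℝ ∙ e)ᗮ → ℝ) : Prop :=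
  ∀ᶠ y in 𝓝 x, y ∈ s ↔ φ ((ℝ ∙ e)ᗮ.orthogonalProjectionOnto y) < ⟪e, y⟫

/-- Open sets with Lipschitz boundary. -/
def IsLipschitzOpen (s : Set (E d)) : Prop :=
  IsOpen s ∧ ∀ x ∈ frontier s, ∃ e : E d, ‖e‖ = 1 ∧ ∃ φ : (ℝ ∙ e)ᗮ → ℝ,
    (∃ C, LipschitzWith C φ) ∧ IsLocalEpigraph s x e φ

/-- Open sets with smooth boundary. -/
def IsSmoothOpen (s : Set (E d)) : Prop :=
  IsOpen s ∧ ∀ x ∈ frontier s, ∃ e : E d, ‖e‖ = 1 ∧ ∃ φ : (ℝ ∙ e)ᗮ → ℝ,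
    ContDiff ℝ ∞ φ ∧ IsLocalEpigraph s x e φ

/-- The cone of vertex `y`, direction `ξ` and dimension `ε`. -/
def cone (y ξ : E d) (ε : ℝ) : Set (E d) :=
  {z | Real.cos ε * ‖z - y‖ ≤ ⟪z - y, ξ⟫ ∧ 0 < ‖z - y‖ ∧ ‖z - y‖ < ε}

/-- The `ε`-cone property. The condition makes sense for every subset of `ℝ^d`; below it is used for
the complement of a bounded open set. -/
def HasConeProperty (ε : ℝ) (Θ : Set (E d)) : Prop :=
  ∀ x ∈ frontier Θ, ∃ ξ : E d, ‖ξ‖ = 1 ∧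
    ∀ y ∈ closure Θ ∩ Metric.ball x ε, cone y ξ ε ⊆ Θ

/-! ### Admissible classes -/

/-- The class `𝒜` of all `A = Ω \ closure W`, with `W ⊆ K` open and Lipschitz. -/
def admissible (Ω K : Set (E d)) : Set (Set (E d)) :=
  {A | ∃ W : Set (E d), IsOpen W ∧ W ⊆ K ∧ IsLipschitzOpen W ∧ A = Ω \ closure W}

/-- The class `𝒜_ε` of all `A = Ω \ closure W`, with `W ⊆ K` open such that the complement of `W`
has the `ε`-cone property. -/
def admissibleCone (Ω K : Set (E d)) (ε : ℝ) : Set (Set (E d)) :=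
  {A | ∃ W : Set (E d), IsOpen W ∧ W ⊆ K ∧ HasConeProperty ε Wᶜ ∧ A = Ω \ closure W}

/-! ### The Sobolev space `H¹(A)` -/

/-- The pairs `(u, G)` of a square integrable function and a square integrable vector field on `A`,
with the Hilbert norm `(‖u‖² + ‖G‖²)^{1/2}`. -/
abbrev L2Pair (A : Set (E d)) : Type :=
  WithLp 2 (Lp ℝ 2 ((volume : Measure (E d)).restrict A) ×
    Lp (E d) 2 ((volume : Measure (E d)).restrict A))

/-- `G` is the weak gradient of `u` in `A`. -/
def IsWeakGradient (A : Set (E d)) (u : E d → ℝ) (G : E d → E d) : Prop :=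
  ∀ ψ : E d → ℝ, ContDiff ℝ ∞ ψ → HasCompactSupport ψ → tsupport ψ ⊆ A →
    ∫ x in A, u x • gradient ψ x = - ∫ x in A, ψ x • G x

lemma continuous_gradient {ψ : E d → ℝ} (hψ : ContDiff ℝ ∞ ψ) : Continuous (gradient ψ) :=
  (InnerProductSpace.toDual ℝ (E d)).symm.continuous.comp (hψ.continuous_fderiv (by simp))

lemma hasCompactSupport_gradient {ψ : E d → ℝ} (hψ : HasCompactSupport ψ) :
    HasCompactSupport (gradient ψ) :=
  (hψ.fderiv (𝕜 := ℝ)).comp_left (g := (InnerProductSpace.toDual ℝ (E d)).symm) (map_zero _)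

lemma integrable_smul_gradient {A : Set (E d)} {ψ : E d → ℝ} (hψ : ContDiff ℝ ∞ ψ)
    (hc : HasCompactSupport ψ) (u : Lp ℝ 2 ((volume : Measure (E d)).restrict A)) :
    Integrable (fun x => u x • gradient ψ x) ((volume : Measure (E d)).restrict A) :=
  memLp_one_iff_integrable.1 <|
    (((continuous_gradient hψ).memLp_of_hasCompactSupport (p := 2)
      (hasCompactSupport_gradient hc)).restrict A).smul (Lp.memLp u)

lemma integrable_smul_field {A : Set (E d)} {ψ : E d → ℝ} (hψ : ContDiff ℝ ∞ ψ)
    (hc : HasCompactSupport ψ) (G : Lp (E d) 2 ((volume : Measure (E d)).restrict A)) :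
    Integrable (fun x => ψ x • G x) ((volume : Measure (E d)).restrict A) :=
  memLp_one_iff_integrable.1 <| (Lp.memLp G).smul
    ((hψ.continuous.memLp_of_hasCompactSupport (p := 2) hc).restrict A)

/-- The Sobolev space `H¹(A)`: its elements are the pairs `(u, ∇u)`, and its inner product is
`∫_A u v + ∫_A ∇u · ∇v`. -/
def H1 (A : Set (E d)) : Submodule ℝ (L2Pair A) where
  carrier := {p | IsWeakGradient A p.fst p.snd}
  zero_mem' := by
    intro ψ _ _ _
    have h1 : ∀ᵐ x ∂(volume : Measure (E d)).restrict A,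
        ((0 : L2Pair A).fst : E d → ℝ) x • gradient ψ x = 0 := by
      filter_upwards [Lp.coeFn_zero ℝ 2 ((volume : Measure (E d)).restrict A)] with x hx
      rw [WithLp.zero_fst, hx, Pi.zero_apply, zero_smul]
    have h2 : ∀ᵐ x ∂(volume : Measure (E d)).restrict A,
        ψ x • ((0 : L2Pair A).snd : E d → E d) x = 0 := by
      filter_upwards [Lp.coeFn_zero (E d) 2 ((volume : Measure (E d)).restrict A)] with x hx
      rw [WithLp.zero_snd, hx, Pi.zero_apply, smul_zero]
    rw [integral_congr_ae h1, integral_congr_ae h2]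
    simp
  add_mem' := by
    intro p q hp hq ψ hψ hc hs
    have h1 : ∀ᵐ x ∂(volume : Measure (E d)).restrict A,
        ((p + q).fst : E d → ℝ) x • gradient ψ x
          = p.fst x • gradient ψ x + q.fst x • gradient ψ x := by
      filter_upwards [Lp.coeFn_add p.fst q.fst] with x hx
      rw [WithLp.add_fst, hx, Pi.add_apply, add_smul]
    have h2 : ∀ᵐ x ∂(volume : Measure (E d)).restrict A,
        ψ x • ((p + q).snd : E d → E d) x = ψ x • p.snd x + ψ x • q.snd x := by
      filter_upwards [Lp.coeFn_add p.snd q.snd] with x hx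
      rw [WithLp.add_snd, hx, Pi.add_apply, smul_add]
    rw [integral_congr_ae h1, integral_congr_ae h2,
      integral_add (integrable_smul_gradient hψ hc _) (integrable_smul_gradient hψ hc _),
      integral_add (integrable_smul_field hψ hc _) (integrable_smul_field hψ hc _),
      hp ψ hψ hc hs, hq ψ hψ hc hs, neg_add]
  smul_mem' := by
    intro c p hp ψ hψ hc hs
    have h1 : ∀ᵐ x ∂(volume : Measure (E d)).restrict A,
        ((c • p).fst : E d → ℝ) x • gradient ψ x = c • (p.fst x • gradient ψ x) := by
      filter_upwards [Lp.coeFn_smul c p.fst] with x hx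
      rw [WithLp.smul_fst, hx, Pi.smul_apply, smul_assoc]
    have h2 : ∀ᵐ x ∂(volume : Measure (E d)).restrict A,
        ψ x • ((c • p).snd : E d → E d) x = c • (ψ x • p.snd x) := by
      filter_upwards [Lp.coeFn_smul c p.snd] with x hx
      rw [WithLp.smul_snd, hx, Pi.smul_apply, smul_comm]
    rw [integral_congr_ae h1, integral_congr_ae h2, integral_smul, integral_smul,
      hp ψ hψ hc hs, smul_neg]

/-! ### Traces and boundary spaces -/

/-- The surface measure on hypersurfaces of `ℝ^d`: the `(d-1)`-dimensional Hausdorff measure,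
normalised so as to agree with Lebesgue measure in dimension `d - 1`. -/
def surf (d : ℕ) : Measure (E d) := Measure.euclideanHausdorffMeasure (d - 1)

/-- `L²(Γ)` for a piece `Γ` of a hypersurface. -/
abbrev L2Bd (Γ : Set (E d)) : Type := Lp ℝ 2 ((surf d).restrict Γ)

/-- `g ∈ L²(Γ)` is the trace on `Γ ⊆ ∂A` of `u ∈ H¹(A)`: there are functions `φ n`, smooth up to the
boundary, with `φ n → u` in `H¹(A)` and `φ n → g` in `L²(Γ)`. -/
def HasTraceOn (A Γ : Set (E d)) (u : H1 A) (g : L2Bd Γ) : Prop :=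
  ∃ φ : ℕ → E d → ℝ, (∀ n, ContDiff ℝ ∞ (φ n) ∧ HasCompactSupport (φ n)) ∧
    Tendsto (fun n => eLpNorm (fun x => φ n x - u.1.fst x) 2 (volume.restrict A)) atTop (𝓝 0) ∧
    Tendsto (fun n => eLpNorm (fun x => gradient (φ n) x - u.1.snd x) 2 (volume.restrict A))
      atTop (𝓝 0) ∧
    Tendsto (fun n => eLpNorm (fun x => φ n x - g x) 2 ((surf d).restrict Γ)) atTop (𝓝 0)

lemma gradient_add' {φ ψ : E d → ℝ} (hφ : ContDiff ℝ ∞ φ) (hψ : ContDiff ℝ ∞ ψ) (x : E d) :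
    gradient (fun y => φ y + ψ y) x = gradient φ x + gradient ψ x := by
  have h1 : DifferentiableAt ℝ φ x := (hφ.differentiable (by simp)) x
  have h2 : DifferentiableAt ℝ ψ x := (hψ.differentiable (by simp)) x
  simp only [gradient]
  rw [fderiv_fun_add h1 h2, map_add]

lemma gradient_const_mul' {φ : E d → ℝ} (hφ : ContDiff ℝ ∞ φ) (c : ℝ) (x : E d) :
    gradient (fun y => c * φ y) x = c • gradient φ x := by
  have h1 : DifferentiableAt ℝ φ x := (hφ.differentiable (by simp)) x
  simp only [gradient]
  rw [fderiv_const_mul h1, map_smul]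

/-- Sums of sequences converging in `L²`, the sequences being continuous. -/
lemma tendsto_eLpNorm_add {F : Type*} [NormedAddCommGroup F] {μ : Measure (E d)}
    [SecondCountableTopology F] [MeasurableSpace F] [BorelSpace F]
    {f g : ℕ → E d → F} (hf : ∀ n, Continuous (f n)) (hg : ∀ n, Continuous (g n))
    (u v w : Lp F 2 μ) (hw : w = u + v)
    (h1 : Tendsto (fun n => eLpNorm (fun x => f n x - u x) 2 μ) atTop (𝓝 0))
    (h2 : Tendsto (fun n => eLpNorm (fun x => g n x - v x) 2 μ) atTop (𝓝 0)) :
    Tendsto (fun n => eLpNorm (fun x => (f n x + g n x) - w x) 2 μ) atTop (𝓝 0) := by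
  refine tendsto_of_tendsto_of_tendsto_of_le_of_le tendsto_const_nhds
    (by simpa using h1.add h2) (fun _ => zero_le) (fun n => ?_)
  have h : eLpNorm (fun x => (f n x + g n x) - w x) 2 μ
      = eLpNorm ((fun x => f n x - u x) + (fun x => g n x - v x)) 2 μ := by
    refine eLpNorm_congr_ae ?_
    subst hw
    filter_upwards [Lp.coeFn_add u v] with x hx
    rw [hx]
    simp only [Pi.add_apply]
    abel
  rw [h]
  exact eLpNorm_add_le ((hf n).aestronglyMeasurable.sub (Lp.aestronglyMeasurable u))
    ((hg n).aestronglyMeasurable.sub (Lp.aestronglyMeasurable v)) (by norm_num)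

/-- Multiples of a sequence converging in `L²`. -/
lemma tendsto_eLpNorm_smul {F : Type*} [NormedAddCommGroup F] [NormedSpace ℝ F]
    {μ : Measure (E d)} {f : ℕ → E d → F} (c : ℝ) (u w : Lp F 2 μ) (hw : w = c • u)
    (h1 : Tendsto (fun n => eLpNorm (fun x => f n x - u x) 2 μ) atTop (𝓝 0)) :
    Tendsto (fun n => eLpNorm (fun x => c • f n x - w x) 2 μ) atTop (𝓝 0) := by
  have h : ∀ n, eLpNorm (fun x => c • f n x - w x) 2 μ
      = ‖c‖ₑ * eLpNorm (fun x => f n x - u x) 2 μ := by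
    intro n
    rw [← eLpNorm_const_smul]
    refine eLpNorm_congr_ae ?_
    subst hw
    filter_upwards [Lp.coeFn_smul c u] with x hx
    rw [hx]
    simp only [Pi.smul_apply, smul_sub]
  simp only [h]
  simpa using ENNReal.Tendsto.const_mul h1 (Or.inr (by simp))

lemma HasTraceOn.add {A Γ : Set (E d)} {u v : H1 A} {g h : L2Bd Γ}
    (hu : HasTraceOn A Γ u g) (hv : HasTraceOn A Γ v h) : HasTraceOn A Γ (u + v) (g + h) := by
  obtain ⟨φ, hφ, h1, h2, h3⟩ := hu
  obtain ⟨ψ, hψ, k1, k2, k3⟩ := hv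
  refine ⟨fun n x => φ n x + ψ n x, fun n => ⟨(hφ n).1.add (hψ n).1, (hφ n).2.add (hψ n).2⟩,
    ?_, ?_, ?_⟩
  · exact tendsto_eLpNorm_add (fun n => (hφ n).1.continuous) (fun n => (hψ n).1.continuous)
      _ _ _ rfl h1 k1
  · simp only [gradient_add' (hφ _).1 (hψ _).1]
    exact tendsto_eLpNorm_add (fun n => continuous_gradient (hφ n).1)
      (fun n => continuous_gradient (hψ n).1) _ _ _ rfl h2 k2
  · exact tendsto_eLpNorm_add (fun n => (hφ n).1.continuous) (fun n => (hψ n).1.continuous)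
      _ _ _ rfl h3 k3

lemma HasTraceOn.smul {A Γ : Set (E d)} {u : H1 A} {g : L2Bd Γ} (c : ℝ)
    (hu : HasTraceOn A Γ u g) : HasTraceOn A Γ (c • u) (c • g) := by
  obtain ⟨φ, hφ, h1, h2, h3⟩ := hu
  refine ⟨fun n x => c * φ n x, fun n => ⟨contDiff_const.mul (hφ n).1, (hφ n).2.mul_left⟩,
    ?_, ?_, ?_⟩
  · exact tendsto_eLpNorm_smul c _ _ rfl h1
  · simp only [gradient_const_mul' (hφ _).1]
    exact tendsto_eLpNorm_smul c _ _ rfl h2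
  · exact tendsto_eLpNorm_smul c _ _ rfl h3

lemma HasTraceOn.zero (A Γ : Set (E d)) : HasTraceOn A Γ (0 : H1 A) 0 := by
  have key : ∀ {F : Type} [NormedAddCommGroup F] (μ : Measure (E d)),
      eLpNorm (fun x => (0 : F) - (0 : Lp F 2 μ) x) 2 μ = 0 := by
    intro F _ μ
    rw [eLpNorm_congr_ae (g := fun _ => (0 : F))]
    · simp
    · filter_upwards [Lp.coeFn_zero F 2 μ] with x hx
      rw [hx, Pi.zero_apply, sub_zero]
  have hg : ∀ x : E d, gradient (fun _ : E d => (0 : ℝ)) x = 0 := by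
    intro x
    simp [gradient]
  refine ⟨fun _ _ => 0, fun _ => ⟨contDiff_const, HasCompactSupport.zero⟩, ?_, ?_, ?_⟩
  · exact tendsto_const_nhds.congr (fun _ => (key _).symm)
  · simp only [hg]
    exact tendsto_const_nhds.congr (fun _ => (key _).symm)
  · exact tendsto_const_nhds.congr (fun _ => (key _).symm)

/-- The space `H^{1/2}(∂Ω)`: the traces on `∂Ω` of the functions of `H¹(Ω)`. -/
def HHalf (Ω : Set (E d)) : Submodule ℝ (L2Bd (frontier Ω)) where
  carrier := {g | ∃ w : H1 Ω, HasTraceOn Ω (frontier Ω) w g}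
  zero_mem' := ⟨0, HasTraceOn.zero _ _⟩
  add_mem' := fun ⟨w, hw⟩ ⟨z, hz⟩ => ⟨w + z, hw.add hz⟩
  smul_mem' := fun c _ ⟨w, hw⟩ => ⟨c • w, hw.smul c⟩

/-- The (quotient) norm of `H^{1/2}(∂Ω)`: the infimum of `‖w‖` in `H¹(Ω)` over all `w` with
trace `g`. -/
def hHalfNorm {Ω : Set (E d)} (g : HHalf Ω) : ℝ :=
  ⨅ w : {w : H1 Ω // HasTraceOn Ω (frontier Ω) w g.1}, ‖w.1‖

/-- The space `H^{-1/2}(∂Ω)`: the linear forms on `H^{1/2}(∂Ω)` that are bounded for its norm. -/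
def HMinusHalf (Ω : Set (E d)) : Submodule ℝ (HHalf Ω →ₗ[ℝ] ℝ) where
  carrier := {ℓ | ∃ C : ℝ, ∀ g, |ℓ g| ≤ C * hHalfNorm g}
  zero_mem' := ⟨0, fun g => by simp⟩
  add_mem' := fun ⟨C, hC⟩ ⟨D, hD⟩ => ⟨C + D, fun g =>
    (abs_add_le _ _).trans (by rw [add_mul]; exact add_le_add (hC g) (hD g))⟩
  smul_mem' := fun c _ ⟨C, hC⟩ => ⟨|c| * C, fun g => by
    rw [LinearMap.smul_apply, smul_eq_mul, abs_mul, mul_assoc]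
    exact mul_le_mul_of_nonneg_left (hC g) (abs_nonneg c)⟩

/-! ### The state equation and the least-squares functional -/

/-- `u ∈ H¹(A)` is the (weak) solution of `-Δu + u = 0` in `A`, `∂_ν u = gN` on `∂Ω`, `u = 0` on the
remaining part `∂A \ ∂Ω` of the boundary, which is `∂W` when `A = Ω \ closure W`: the function `u`
vanishes on `∂A \ ∂Ω`, and `∫_A ∇u · ∇v + u v = ⟨gN, v⟩` for every `v ∈ H¹(A)` which vanishes
there, `h` being the trace of `v` on `∂Ω`. -/
def IsWeakSolution (Ω : Set (E d)) (gN : HMinusHalf Ω) (A : Set (E d)) (u : H1 A) : Prop :=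
  HasTraceOn A (frontier A \ frontier Ω) u 0 ∧
    ∀ v : H1 A, HasTraceOn A (frontier A \ frontier Ω) v 0 →
      ∀ h : HHalf Ω, HasTraceOn A (frontier Ω) v h.1 → ⟪u, v⟫ = gN.1 h

open Classical in
/-- The least-squares functional `𝓛(A) = 1/2 ∫_{∂Ω} |u - gD|²`, with `u` the solution of the state
equation in `A`; `p` is the pair formed by `u` and its trace on `∂Ω`. On the admissible sets, this
pair exists and is unique (the state equation is well-posed); the value `0` elsewhere is
immaterial. -/
def misfit (Ω : Set (E d)) (gN : HMinusHalf Ω) (gD : HHalf Ω) (A : Set (E d)) : ℝ :=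
  if h : ∃ p : H1 A × L2Bd (frontier Ω),
      IsWeakSolution Ω gN A p.1 ∧ HasTraceOn A (frontier Ω) p.1 p.2 then
    1 / 2 * ∫ x in frontier Ω, |h.choose.2 x - gD.1 x| ^ 2 ∂(surf d)
  else 0

/-- `A` minimises the functional `J` over the class `𝒞`. -/
def IsMinimizer (J : Set (E d) → ℝ) (𝒞 : Set (Set (E d))) (A : Set (E d)) : Prop :=
  A ∈ 𝒞 ∧ ∀ B ∈ 𝒞, J A ≤ J B

end Obstacle

end

namespace Obstacle

variable {d : ℕ}

/-! The argument compares the two classes; the state equation plays no role. For `ε < π/2` the cone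
property of the complement forces a Lipschitz boundary, so `𝒜_ε ⊆ 𝒜`
(`admissibleCone_subset_admissible`). Conversely, a compact Lipschitz boundary has the cone property
with one aperture for all its points, so each fixed member of `𝒜` lies in `𝒜_ε` for all small `ε`
(`eventually_mem_admissibleCone`). A minimizer over the larger class that belongs to the smaller one
minimizes there too. -/

lemma norm_sq_eq_inner_sq_add {e : E d} (he : ‖e‖ = 1) (v : E d) :
    ‖v‖ ^ 2 = ⟪e, v⟫ ^ 2 + ‖(ℝ ∙ e)ᗮ.orthogonalProjectionOnto v‖ ^ 2 := by
  have h : ‖(ℝ ∙ e).orthogonalProjectionOnto v‖ = |⟪e, v⟫| := by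
    rw [Submodule.coe_norm, ← Submodule.starProjection_apply,
      Submodule.starProjection_unit_singleton ℝ he, norm_smul, he, mul_one, Real.norm_eq_abs]
  rw [Submodule.norm_sq_eq_add_norm_sq_projection v (ℝ ∙ e), h, sq_abs]

/-- A vector makes an angle at most `ε` with `e` iff its horizontal part is controlled by its
height. -/
lemma cos_mul_norm_le_iff {e : E d} (he : ‖e‖ = 1) {ε : ℝ} (hc : 0 ≤ Real.cos ε)
    (hs : 0 ≤ Real.sin ε) {v : E d} {a : ℝ} (ha : 0 ≤ a) (hav : a ^ 2 = ⟪e, v⟫ ^ 2) :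
    Real.cos ε * ‖v‖ ≤ a ↔
      Real.cos ε * ‖(ℝ ∙ e)ᗮ.orthogonalProjectionOnto v‖ ≤ Real.sin ε * a := by
  have h := norm_sq_eq_inner_sq_add he v
  have h1 := Real.sin_sq_add_cos_sq ε
  -- All terms are nonnegative, so squaring is harmless; Pythagoras and `sin² = 1 - cos²` then match
  -- the two sides.
  rw [← sq_le_sq₀ (a := Real.cos ε * ‖v‖) (by positivity) ha,
    ← sq_le_sq₀ (b := Real.sin ε * a) (by positivity) (by positivity), mul_pow, mul_pow,
    mul_pow, h, ← hav, eq_sub_of_add_eq h1]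
  constructor <;> intro h2 <;> linarith

/-! ### From cones to Lipschitz graphs -/

/-- Near `x`, the complement of `W` is a union of parallel truncated cones with vertices in it. The
upper envelope of their lateral surfaces is the required graph: a supremum of functions with a
common Lipschitz constant. -/
lemma HasConeProperty.exists_isLocalEpigraph {W : Set (E d)} (hW : IsOpen W) {ε : ℝ}
    (hε : 0 < ε) (hε' : ε < Real.pi / 2) (h : HasConeProperty ε Wᶜ) {x : E d}
    (hx : x ∈ frontier W) :
    ∃ e : E d, ‖e‖ = 1 ∧ ∃ φ : (ℝ ∙ e)ᗮ → ℝ,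
      (∃ C, LipschitzWith C φ) ∧ IsLocalEpigraph W x e φ := by
  obtain ⟨ξ, hξ, hcone⟩ := h x (by rwa [frontier_compl])
  have hcl : IsClosed Wᶜ := hW.isClosed_compl
  have hc : 0 < Real.cos ε := Real.cos_pos_of_mem_Ioo ⟨by linarith [Real.pi_pos], hε'⟩
  have hs : 0 < Real.sin ε := Real.sin_pos_of_pos_of_lt_pi hε (by linarith [Real.pi_pos])
  have he : ‖-ξ‖ = 1 := by rwa [norm_neg]
  refine ⟨-ξ, he, ?_⟩
  set P := (ℝ ∙ (-ξ))ᗮ.orthogonalProjectionOnto with hP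
  -- The slope `cot ε` of the lateral surface of a cone of half-angle `ε`.
  set L : NNReal := ⟨Real.cos ε / Real.sin ε, by positivity⟩ with hL
  have hLs : (L : ℝ) * Real.sin ε = Real.cos ε := div_mul_cancel₀ _ hs.ne'
  -- Points of this ball are at most `2ε/3 < ε` apart, within the length of the cones; compactness
  -- makes the supremum attained.
  set S : Set (E d) := Wᶜ ∩ Metric.closedBall x (ε / 3) with hS
  have hSc : IsCompact S := (isCompact_closedBall x (ε / 3)).inter_left hcl
  have hxS : x ∈ S := by
    refine ⟨fun hxW => ?_, Metric.mem_closedBall_self (by positivity)⟩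
    rw [hW.frontier_eq] at hx
    exact hx.2 hxW
  -- Height above `p` of the surface of the infinite cone with vertex `y`, opening downwards.
  set F : (ℝ ∙ (-ξ))ᗮ → E d → ℝ := fun p y => ⟪-ξ, y⟫ - L * dist p (P y) with hF
  have hmax : ∀ p, ∃ s ∈ S, ∀ y ∈ S, F p y ≤ F p s := fun p =>
    have hcont : Continuous (F p) := by fun_prop
    hSc.exists_isMaxOn ⟨x, hxS⟩ hcont.continuousOn
  choose m hmS hm using hmax
  refine ⟨fun p => F p (m p), ⟨L, LipschitzWith.of_le_add_mul L fun p q => ?_⟩, ?_⟩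
  -- The maximizer for `p` serves as a competitor at `q`.
  · refine le_trans ?_ (add_le_add_left (hm q (m p) (hmS p)) _)
    have h1 := mul_le_mul_of_nonneg_left (dist_triangle_left q (P (m p)) p) L.coe_nonneg
    simp only [hF]
    linarith
  · filter_upwards [Metric.closedBall_mem_nhds x (show 0 < ε / 3 by positivity)] with y hy
    rw [← not_iff_not, not_lt]
    constructor
    · intro hyW
      have h1 := hm (P y) y ⟨hyW, hy⟩
      simpa only [hF, dist_self, mul_zero, sub_zero] using h1
    -- If `y` is below the envelope, it is below the surface attaining the maximum at `P y`, hence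
    -- in the cone with vertex `s`.
    · intro hle
      obtain ⟨s, hsm⟩ : ∃ s, m (P y) = s := ⟨_, rfl⟩
      obtain ⟨hsW, hsx⟩ := hmS (P y)
      rw [hsm] at hsW hsx
      have hPd : dist (P y) (P s) = ‖P (y - s)‖ := by rw [dist_eq_norm, map_sub]
      have ha : L * ‖P (y - s)‖ ≤ ⟪y - s, ξ⟫ := by
        have h1 : ⟪-ξ, y⟫ ≤ ⟪-ξ, s⟫ - L * dist (P y) (P s) := hsm ▸ hle
        rw [hPd, inner_neg_left, inner_neg_left] at h1
        rw [real_inner_comm, inner_sub_right]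
        linarith
      have ha0 : 0 ≤ ⟪y - s, ξ⟫ := le_trans (by positivity) ha
      -- The cone omits its vertex.
      rcases eq_or_ne y s with rfl | hne
      · exact hsW
      rw [Metric.mem_closedBall] at hsx hy
      refine hcone s ⟨subset_closure hsW, ?_⟩ ⟨?_, ?_, ?_⟩
      · rw [Metric.mem_ball]
        linarith
      · rw [cos_mul_norm_le_iff he hc.le hs.le ha0
          (by rw [inner_neg_left, neg_sq, real_inner_comm]), ← hLs]
        calc L * Real.sin ε * ‖P (y - s)‖ = Real.sin ε * (L * ‖P (y - s)‖) := by ring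
          _ ≤ _ := mul_le_mul_of_nonneg_left ha hs.le
      · exact norm_pos_iff.2 (sub_ne_zero.2 hne)
      · rw [← dist_eq_norm]
        linarith [dist_triangle_right y s x]

/-! ### From Lipschitz graphs to cones -/

/-- The points below a Lipschitz graph satisfy the cone property, uniformly near a given point. -/
lemma IsLocalEpigraph.eventually_cone_subset {W : Set (E d)} (hW : IsOpen W) {x e : E d}
    (he : ‖e‖ = 1) {φ : (ℝ ∙ e)ᗮ → ℝ} {C : NNReal} (hφ : LipschitzWith C φ)
    (h : IsLocalEpigraph W x e φ) :
    ∀ᶠ z : ℝ × E d in 𝓝 (0, x), 0 < z.1 →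
      ∀ y ∈ closure Wᶜ ∩ Metric.ball z.2 z.1, cone y (-e) z.1 ⊆ Wᶜ := by
  obtain ⟨r, hr, hball⟩ := Metric.eventually_nhds_iff.1 h
  -- The cone must be steeper than the graph; at `ε = 0` this reads `0 < 1`.
  have hsin : ∀ᶠ ε : ℝ in 𝓝 0, C * Real.sin ε < Real.cos ε :=
    (by fun_prop : Continuous fun ε : ℝ => C * Real.sin ε).continuousAt.eventually_lt
      Real.continuous_cos.continuousAt (by simp)
  -- With `x'` within `r/4` of `x`, the chain `x, x', y, z` has length below `3r/4`, so `y` and `z`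
  -- stay in the graph's ball.
  have hsmall : ∀ᶠ ε : ℝ in 𝓝 0, ε < r / 4 ∧ ε < Real.pi / 2 :=
    (eventually_lt_nhds (by positivity)).and (eventually_lt_nhds (by positivity))
  have h1 : ∀ᶠ z : ℝ × E d in 𝓝 (0, x),
      C * Real.sin z.1 < Real.cos z.1 ∧ z.1 < r / 4 ∧ z.1 < Real.pi / 2 :=
    (continuousAt_fst (p := ((0 : ℝ), x))).eventually (hsin.and hsmall)
  have h2 : ∀ᶠ z : ℝ × E d in 𝓝 (0, x), dist z.2 x < r / 4 :=
    (continuousAt_snd (p := ((0 : ℝ), x))).eventually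
      (Metric.ball_mem_nhds x (show 0 < r / 4 by positivity))
  filter_upwards [h1, h2]
  rintro ⟨ε, x'⟩ ⟨hsc, hεr, hεπ⟩ hx' hε y ⟨hy, hyx⟩ z ⟨hz, -, hzε⟩ hzW
  simp only at hsc hεr hεπ hx' hε hyx hz hzε
  rw [hW.isClosed_compl.closure_eq] at hy
  rw [Metric.mem_ball] at hyx
  rw [← dist_eq_norm] at hzε
  have hc : 0 < Real.cos ε := Real.cos_pos_of_mem_Ioo ⟨by linarith, hεπ⟩
  have hs : 0 < Real.sin ε := Real.sin_pos_of_pos_of_lt_pi hε (by linarith)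
  have hyr : dist y x < r := by linarith [dist_triangle y x' x]
  have hzr : dist z x < r := by linarith [dist_triangle z y x, dist_triangle y x' x]
  have hyφ := not_lt.1 (mt (hball hyr).2 hy)
  have hzφ := (hball hzr).1 hzW
  set P := (ℝ ∙ e)ᗮ.orthogonalProjectionOnto with hP
  have ha0 : 0 ≤ ⟪z - y, -e⟫ := le_trans (by positivity) hz
  rw [cos_mul_norm_le_iff he hc.le hs.le ha0
    (by rw [inner_neg_right, neg_sq, real_inner_comm])] at hz
  have hlip : φ (P y) - φ (P z) ≤ C * ‖P (z - y)‖ := by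
    rw [map_sub, ← dist_eq_norm, dist_comm]
    exact (le_abs_self _).trans (hφ.dist_le_mul _ _)
  have ha : ⟪z - y, -e⟫ = ⟪e, y⟫ - ⟪e, z⟫ := by
    rw [inner_neg_right, real_inner_comm, inner_sub_right, neg_sub]
  -- Passing from below the graph to above it, `z` descends from `y` by less than the graph does,
  -- which the steepness of the cone forbids.
  have hlt : ⟪z - y, -e⟫ < C * ‖P (z - y)‖ := by rw [ha]; linarith
  have h3 : Real.cos ε * (C * ‖P (z - y)‖) ≤ Real.cos ε * ⟪z - y, -e⟫ :=
    calc Real.cos ε * (C * ‖P (z - y)‖) = C * (Real.cos ε * ‖P (z - y)‖) := by ring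
      _ ≤ C * (Real.sin ε * ⟪z - y, -e⟫) := by gcongr
      _ = C * Real.sin ε * ⟪z - y, -e⟫ := by ring
      _ ≤ Real.cos ε * ⟪z - y, -e⟫ := by gcongr
  exact absurd (lt_of_mul_lt_mul_left (h3.trans_lt (mul_lt_mul_of_pos_left hlt hc)) hc.le)
    (lt_irrefl _)

/-- The complement of an open set with compact Lipschitz boundary has the `ε`-cone property for all
small `ε`. -/
lemma IsLipschitzOpen.eventually_hasConeProperty_compl {W : Set (E d)} (hW : IsLipschitzOpen W)
    (hc : IsCompact (frontier W)) : ∀ᶠ ε : ℝ in 𝓝 0, 0 < ε → HasConeProperty ε Wᶜ := by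
  -- One direction serves all boundary points near `x`. The local estimate holds jointly in `(ε,
  -- x)`, so compactness gives a range of `ε` valid on the whole boundary.
  have h := hc.eventually_forall_of_forall_eventually (x₀ := (0 : ℝ))
    (P := fun ε x => 0 < ε → ∃ ξ : E d, ‖ξ‖ = 1 ∧
      ∀ y ∈ closure Wᶜ ∩ Metric.ball x ε, cone y ξ ε ⊆ Wᶜ) (fun x hx => by
        obtain ⟨e, he, φ, ⟨C, hφ⟩, hepi⟩ := hW.2 x hx
        filter_upwards [hepi.eventually_cone_subset hW.1 he hφ] with z hz hz0
        exact ⟨-e, by rwa [norm_neg], hz hz0⟩)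
  filter_upwards [h] with ε hε hε0 x hx
  exact hε x (by rwa [frontier_compl] at hx) hε0

/-! ### Comparison of the two classes -/

lemma admissibleCone_subset_admissible (Ω K : Set (E d)) {ε : ℝ} (hε : 0 < ε)
    (hε' : ε < Real.pi / 2) : admissibleCone Ω K ε ⊆ admissible Ω K := by
  rintro A ⟨W, hW, hWK, hcone, rfl⟩
  exact ⟨W, hW, hWK, ⟨hW, fun x hx => hcone.exists_isLocalEpigraph hW hε hε' hx⟩, rfl⟩

lemma eventually_mem_admissibleCone {Ω K A : Set (E d)} (hK : IsCompact K)
    (hA : A ∈ admissible Ω K) : ∀ᶠ ε : ℝ in 𝓝 0, 0 < ε → A ∈ admissibleCone Ω K ε := by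
  obtain ⟨W, hW, hWK, hWL, rfl⟩ := hA
  have hc : IsCompact (frontier W) := hK.of_isClosed_subset isClosed_frontier
    (frontier_subset_closure.trans (closure_minimal hWK hK.isClosed))
  filter_upwards [hWL.eventually_hasConeProperty_compl hc] with ε hε hε0
  exact ⟨W, hW, hWK, hε hε0, rfl⟩

end Obstacle

theorem proposition2p5 {d : ℕ} (hd : 1 ≤ d) (Ω K : Set (Obstacle.E d))
    (hΩ : Obstacle.IsSmoothOpen Ω) (hΩb : Bornology.IsBounded Ω) (hΩc : IsConnected Ω)
    (hK : IsCompact K) (hKΩ : K ⊆ Ω)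
    (gN : Obstacle.HMinusHalf Ω) (gD : Obstacle.HHalf Ω) (hg : (gN, gD) ≠ 0)
    (Astar : Set (Obstacle.E d))
    (hA : Obstacle.IsMinimizer (Obstacle.misfit Ω gN gD) (Obstacle.admissible Ω K) Astar) :
    ∃ ε₀ : ℝ, 0 < ε₀ ∧ ∀ ε : ℝ, 0 < ε → ε < ε₀ →
      Obstacle.IsMinimizer (Obstacle.misfit Ω gN gD) (Obstacle.admissibleCone Ω K ε) Astar := by
  obtain ⟨r, hr, hball⟩ := Metric.eventually_nhds_iff.1
    (Obstacle.eventually_mem_admissibleCone hK hA.1)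
  -- The bound `r` puts `Astar` in the smaller class; `π/2` gives the inclusion of classes.
  refine ⟨min r (Real.pi / 2), lt_min hr (by positivity), fun ε hε hlt => ?_⟩
  have hεr : dist ε 0 < r := by
    rw [Real.dist_0_eq_abs, abs_of_pos hε]
    exact hlt.trans_le (min_le_left _ _)
  exact ⟨hball hεr hε, fun B hB => hA.2 B
    (Obstacle.admissibleCone_subset_admissible Ω K hε (hlt.trans_le (min_le_right _ _)) hB)⟩
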